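/- An electricity division instance $D$ with $n\ge 1$ households consists of a time interval $[0,T]$ with $T>0$, a supply $S>0$, and real demands $D[1],\dots,D[n]$ with $0<D[i]\le S$. A set $A\subseteq\{1,\dots,n\}$ is admissible if $\sum_{i\in A}D[i]\le S$. A schedule is a partition of $[0,T]$ into finitely many sub-intervals $I_1,\dots,I_p$ together with an admissible set $A_l$ for each $l$; household $i$ is then connected for the time $u_i=\sum_{l:\,i\in A_l}|I_l|$. The egalitarian connection time of $D$ is the maximum of $\min_i u_i$ over all schedules. For an integer $k\ge 1$, a $k$-times bin packing of $D$ is a finite family of admissible sets (bins) such that each $i\in\{1,\dots,n\}$ lies in exactly $k$ of the bins; $OPT(D_k)$ denotes the smallest possible number of bins. Let $K(D)$ be the smallest integer $k\ge 1$ such that the egalitarian connection time of $D$ is the fraction $\frac{k}{OPT(D_k)}$ of the interval, that is, equals $\frac{k}{OPT(D_k)}\,T$, and let $K(n)$ be the maximum of $K(D)$ over all instances $D$ with $n$ households. Proposition. For $n=6$ the numbers $K(D)$ and the maximum $K(6)$ are well defined, and $$K(6)=9.$$ The maximum is attained by the demands $[4,2,5,3,2,1]$ with $S=9$: for this instance $OPT(D_9)=17$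 and $K(D)=9$. -/

import Mathlib

/-- An electricity division instance with `n` households: a time interval `[0, T]`, a supply `S`,
and a list of positive demands, each of which can be served on its own (otherwise no packing of
the households exists). -/
structure ElectricityInstance (n : ℕ) where
  /-- The length `T` of the time interval `[0, T]`. -/
  horizon : ℝ
  /-- The supply `S`, which is also the bin capacity. -/
  supply : ℝ
  /-- The demand `D[i]` of household `i`. -/
  demand : Fin n → ℝ
  horizon_pos : 0 < horizon
  supply_pos : 0 < supply
  demand_pos : ∀ i, 0 < demand i
  demand_le_supply : ∀ i, demand i ≤ supply

namespace ElectricityInstance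

/-- A set of households that can be connected simultaneously
(equivalently, the content of an admissible bin). -/
def Admissible {n : ℕ} (D : ElectricityInstance n) (A : Finset (Fin n)) : Prop :=
  ∑ i ∈ A, D.demand i ≤ D.supply

/-- A schedule: a partition `0 = t₀ ≤ t₁ ≤ ⋯ ≤ t_p = T` of `[0, T]` into consecutive
sub-intervals, and for each of them an admissible set of connected households. -/
structure Schedule {n : ℕ} (D : ElectricityInstance n) where
  /-- The number of sub-intervals. -/
  p : ℕ
  /-- The end points of the sub-intervals. -/
  t : Fin (p + 1) → ℝ
  t_mono : Monotone t
  t_zero : t 0 = 0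
  t_last : t (Fin.last p) = D.horizon
  /-- The set of households connected during the `l`-th sub-interval. -/
  connected : Fin p → Finset (Fin n)
  admissible : ∀ l, D.Admissible (connected l)

/-- The total time during which household `i` is connected. -/
def Schedule.utility {n : ℕ} {D : ElectricityInstance n} (σ : D.Schedule) (i : Fin n) : ℝ :=
  ∑ l : Fin σ.p with i ∈ σ.connected l, (σ.t l.succ - σ.t l.castSucc)

/-- `v` is the egalitarian connection time `max_σ min_i u_i(σ)`; the maximum is attained.
(The infimum over `Fin n` is a minimum as soon as there is a household.) -/
def IsEgalitarianTime {n : ℕ} (D : ElectricityInstance n) (v : ℝ) : Prop :=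
  IsGreatest (Set.range fun σ : D.Schedule => ⨅ i, σ.utility i) v

/-- `B` is a `k`-times bin packing into `q` bins: every bin respects the capacity and every item
lies in exactly `k` of the bins (at most once in each, since bins are sets of items). -/
def IsPacking {n : ℕ} (D : ElectricityInstance n) (k q : ℕ) (B : Fin q → Finset (Fin n)) : Prop :=
  (∀ j, D.Admissible (B j)) ∧ ∀ i, (Finset.univ.filter fun j => i ∈ B j).card = k

/-- `OPT(D_k)`: the least number of bins in a `k`-times bin packing. -/
noncomputable def opt {n : ℕ} (D : ElectricityInstance n) (k : ℕ) : ℕ :=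
  sInf {q | ∃ B : Fin q → Finset (Fin n), D.IsPacking k q B}

/-- The integers `k ≥ 1` for which the fraction `k / OPT(D_k)` of the time interval is the
egalitarian connection time. -/
def optimalMultiplicities {n : ℕ} (D : ElectricityInstance n) : Set ℕ :=
  {k | 1 ≤ k ∧ D.IsEgalitarianTime ((k : ℝ) / (D.opt k : ℝ) * D.horizon)}

/-- `K(D)`: the smallest `k` such that the egalitarian connection time is `k / OPT(D_k)`. -/
noncomputable def minK {n : ℕ} (D : ElectricityInstance n) : ℕ :=
  sInf D.optimalMultiplicities

end ElectricityInstance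

/-- `K(n)`: the maximum of `K(D)` over all instances `D` with `n` households. -/
noncomputable def maxMinK (n : ℕ) : ℕ :=
  sSup (Set.range fun D : ElectricityInstance n => D.minK)

namespace ElectricityInstance

/-- A `k`-times bin packing into `q` bins whose optimality is witnessed by weights that give every
admissible set a total of at most `1` and all the households together a total of `q / k`. -/
def HasTightPacking {n : ℕ} (D : ElectricityInstance n) (k q : ℕ) : Prop :=
  (∃ B : Fin q → Finset (Fin n), D.IsPacking k q B) ∧
    ∃ y : Fin n → ℝ, (∀ i, 0 ≤ y i) ∧ (∀ A, D.Admissible A → ∑ i ∈ A, y i ≤ 1) ∧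
      (k : ℝ) * ∑ i, y i = q

section Packing

variable {n : ℕ} {D : ElectricityInstance n} {k q : ℕ}

theorem IsPacking.mul_sum_eq {B : Fin q → Finset (Fin n)} (hB : D.IsPacking k q B)
    (y : Fin n → ℝ) : (k : ℝ) * ∑ i, y i = ∑ j, ∑ i ∈ B j, y i := by
  have h : ∀ j, ∑ i ∈ B j, y i = ∑ i, if i ∈ B j then y i else 0 := fun j => by
    rw [Finset.sum_ite_mem, Finset.univ_inter]
  simp_rw [h]
  rw [Finset.sum_comm, Finset.mul_sum]
  refine Finset.sum_congr rfl fun i _ => ?_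
  rw [← Finset.sum_filter, Finset.sum_const, hB.2 i, nsmul_eq_mul]

theorem HasTightPacking.opt_eq (h : D.HasTightPacking k q) : D.opt k = q := by
  obtain ⟨hB, y, -, hy, hsum⟩ := h
  refine le_antisymm (Nat.sInf_le hB) (le_csInf ⟨q, hB⟩ ?_)
  rintro r ⟨C, hC⟩
  have h : (q : ℝ) ≤ ∑ _j : Fin r, (1 : ℝ) := by
    rw [← hsum, hC.mul_sum_eq]
    exact Finset.sum_le_sum fun j _ => hy _ (hC.1 j)
  simpa using h

theorem IsPacking.pos [NeZero n] {B : Fin q → Finset (Fin n)} (hB : D.IsPacking k q B)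
    (hk : 1 ≤ k) : 0 < q := by
  rcases Nat.eq_zero_or_pos q with rfl | h
  · have := hB.2 0
    simp at this
    omega
  · exact h

/-- The schedule that gives every bin of a packing the same amount of time. -/
noncomputable def IsPacking.schedule {B : Fin q → Finset (Fin n)} (hB : D.IsPacking k q B)
    (hq : 0 < q) : D.Schedule where
  p := q
  t l := (l : ℕ) * (D.horizon / q)
  t_mono a b hab := by
    have h : (a : ℕ) ≤ b := hab
    exact mul_le_mul_of_nonneg_right (Nat.cast_le.2 h)
      (div_nonneg D.horizon_pos.le (Nat.cast_nonneg q))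
  t_zero := by simp
  t_last := by
    have : (q : ℝ) ≠ 0 := by positivity
    simp only [Fin.val_last]
    field_simp
  connected := B
  admissible := hB.1

theorem IsPacking.utility_schedule {B : Fin q → Finset (Fin n)} (hB : D.IsPacking k q B)
    (hq : 0 < q) (i : Fin n) :
    (hB.schedule hq).utility i = (k : ℝ) / q * D.horizon := by
  have h : ∀ l : Fin q, (hB.schedule hq).t l.succ - (hB.schedule hq).t l.castSucc =
      D.horizon / q := fun l => by
    simp only [schedule, Fin.val_succ, Fin.val_castSucc]
    push_cast
    ring
  have h' : (hB.schedule hq).utility i =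
      ∑ l : Fin q with i ∈ B l, (D.horizon / q) := Finset.sum_congr rfl fun l _ => h l
  rw [h', Finset.sum_const, hB.2 i, nsmul_eq_mul]
  ring

theorem Schedule.sum_length (σ : D.Schedule) :
    ∑ l : Fin σ.p, (σ.t l.succ - σ.t l.castSucc) = D.horizon := by
  have h : ∀ (p : ℕ) (t : Fin (p + 1) → ℝ),
      ∑ l : Fin p, (t l.succ - t l.castSucc) = t (Fin.last p) - t 0 := by
    intro p
    induction p with
    | zero => intro t; simp
    | succ p ih =>
      intro t
      rw [Fin.sum_univ_castSucc]
      have := ih fun l => t l.castSucc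
      simp only [Fin.castSucc_zero] at this
      simp only [Fin.succ_castSucc, this, Fin.succ_last]
      ring
  rw [h, σ.t_last, σ.t_zero, sub_zero]

theorem Schedule.sum_mul_utility_le (σ : D.Schedule) {y : Fin n → ℝ}
    (hy : ∀ A, D.Admissible A → ∑ i ∈ A, y i ≤ 1) :
    ∑ i, y i * σ.utility i ≤ D.horizon := by
  have h : ∑ i, y i * σ.utility i =
      ∑ l : Fin σ.p, (σ.t l.succ - σ.t l.castSucc) * ∑ i ∈ σ.connected l, y i := by
    simp only [utility, Finset.mul_sum, Finset.sum_filter, mul_ite, mul_zero]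
    rw [Finset.sum_comm]
    refine Finset.sum_congr rfl fun l _ => ?_
    rw [← Finset.sum_filter, Finset.filter_mem_eq_inter, Finset.univ_inter]
    exact Finset.sum_congr rfl fun i _ => mul_comm _ _
  rw [h, ← σ.sum_length]
  refine Finset.sum_le_sum fun l _ => mul_le_of_le_one_right ?_ (hy _ (σ.admissible l))
  exact sub_nonneg.2 (σ.t_mono (Fin.castSucc_le_succ l))

theorem HasTightPacking.isEgalitarianTime [NeZero n] (h : D.HasTightPacking k q) (hk : 1 ≤ k) :
    D.IsEgalitarianTime ((k : ℝ) / q * D.horizon) := by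
  obtain ⟨⟨B, hB⟩, y, hy₀, hy, hsum⟩ := h
  have hq := hB.pos hk
  refine ⟨⟨hB.schedule hq, ?_⟩, ?_⟩
  · simp only [hB.utility_schedule hq]
    exact ciInf_const
  · rintro _ ⟨σ, rfl⟩
    have hk' : (0 : ℝ) < k := by exact_mod_cast hk
    have hq' : (0 : ℝ) < q := by exact_mod_cast hq
    have h₁ : (⨅ i, σ.utility i) * ∑ i, y i ≤ D.horizon := by
      refine le_trans ?_ (σ.sum_mul_utility_le hy)
      rw [Finset.mul_sum]
      refine Finset.sum_le_sum fun i _ => ?_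
      rw [mul_comm]
      exact mul_le_mul_of_nonneg_left (ciInf_le (Set.finite_range _).bddBelow i) (hy₀ i)
    have h₂ : ∑ i, y i = q / k := by
      rw [eq_div_iff hk'.ne', mul_comm]
      exact hsum
    rw [h₂] at h₁
    calc (⨅ i, σ.utility i) = (k : ℝ) / q * ((⨅ i, σ.utility i) * (q / k)) := by
          field_simp
      _ ≤ (k : ℝ) / q * D.horizon := by gcongr

theorem HasTightPacking.mem_optimalMultiplicities [NeZero n] (h : D.HasTightPacking k q)
    (hk : 1 ≤ k) : k ∈ D.optimalMultiplicities := by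
  refine ⟨hk, ?_⟩
  rw [h.opt_eq]
  exact h.isEgalitarianTime hk

/-- If the optimal ratio is `k / q` in lowest terms, no smaller multiplicity attains it. -/
theorem HasTightPacking.minK_eq [NeZero n] (h : D.HasTightPacking k q) (hk : 1 ≤ k)
    (hkq : k.Coprime q) : D.minK = k := by
  refine le_antisymm (Nat.sInf_le (h.mem_optimalMultiplicities hk))
    (le_csInf ⟨k, h.mem_optimalMultiplicities hk⟩ ?_)
  rintro m ⟨hm, hm'⟩
  have e := hm'.unique (h.isEgalitarianTime hk)
  have hT := D.horizon_pos.ne'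
  have hq : (q : ℝ) ≠ 0 := by
    obtain ⟨⟨B, hB⟩, -⟩ := h
    exact_mod_cast (hB.pos hk).ne'
  have hk' : (k : ℝ) ≠ 0 := by positivity
  have e' : (m : ℝ) / D.opt m = k / q := mul_right_cancel₀ hT e
  have ho : (D.opt m : ℝ) ≠ 0 := by
    intro h0
    rw [h0, div_zero] at e'
    exact (div_ne_zero hk' hq) e'.symm
  rw [div_eq_div_iff ho hq] at e'
  have e'' : m * q = k * D.opt m := by exact_mod_cast e'
  exact Nat.le_of_dvd hm (hkq.dvd_of_dvd_mul_right ⟨_, e''⟩)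

/-- The instance in which the households are listed in another order. -/
def permute (D : ElectricityInstance n) (e : Equiv.Perm (Fin n)) : ElectricityInstance n where
  horizon := D.horizon
  supply := D.supply
  demand i := D.demand (e i)
  horizon_pos := D.horizon_pos
  supply_pos := D.supply_pos
  demand_pos i := D.demand_pos (e i)
  demand_le_supply i := D.demand_le_supply (e i)

theorem admissible_permute {e : Equiv.Perm (Fin n)} {A : Finset (Fin n)} :
    (D.permute e).Admissible A ↔ D.Admissible (A.map e.toEmbedding) := by
  simp [Admissible, permute]

theorem HasTightPacking.of_permute {e : Equiv.Perm (Fin n)}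
    (h : (D.permute e).HasTightPacking k q) : D.HasTightPacking k q := by
  obtain ⟨⟨B, hB⟩, y, hy₀, hy, hsum⟩ := h
  refine ⟨⟨fun j => (B j).map e.toEmbedding, fun j => admissible_permute.1 (hB.1 j), fun i => ?_⟩,
    fun i => y (e.symm i), fun i => hy₀ _, fun A hA => ?_, ?_⟩
  · rw [← hB.2 (e.symm i)]
    congr 1
    ext j
    simp [Finset.mem_map_equiv]
  · have := hy (A.map e.symm.toEmbedding) (admissible_permute.2 (by
      convert hA
      ext i
      simp [Finset.mem_map_equiv]))
    simpa using this
  · rw [Equiv.sum_comp e.symm y]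
    exact hsum

end Packing

end ElectricityInstance

/-- The set of the positions at which the binary expansion of `a` has a one. -/
def bitSet (n a : ℕ) : Finset (Fin n) :=
  Finset.univ.filter fun i => a.testBit i

/-- The sum of the entries of a list at the positions where `a` has a binary digit one. -/
def bitSum {R : Type*} [Zero R] [Add R] : List R → ℕ → R
  | [], _ => 0
  | x :: l, a => if a % 2 = 1 then x + bitSum l (a / 2) else bitSum l (a / 2)

/-- Whether `c` plus the number of ones of `a` is at least the number of ones of `b` at each of
the initial segments of the first `n` binary positions. -/
def dominates : ℕ → ℕ → ℕ → ℕ → Bool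
  | 0, _, _, _ => true
  | n + 1, c, a, b =>
    Nat.ble (b % 2) (c + a % 2) && dominates n (c + a % 2 - b % 2) (a / 2) (b / 2)

/-- The number whose binary digits are the values of `p` at `0, …, n - 1`. -/
def bitMask (p : ℕ → Bool) : ℕ → ℕ
  | 0 => 0
  | n + 1 => bitMask p n ||| (bif p n then 1 <<< n else 0)

/-- `f n`, in a form that makes the kernel evaluate `n` first. -/
def evalAt {α : Type} (f : ℕ → α) (n : ℕ) : α :=
  Nat.casesOn n (f 0) fun m => f (Nat.succ m)

/-- A search that shows that every family of sets closed under domination contains all the sets of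
`P` and none of the sets of `Q`, for some `(P, Q)` in a list. The state consists of the sets known
to be in the family and of those known not to be; families and sets are encoded in binary. -/
def familySearch (n : ℕ) : ℕ → List (ℕ × ℕ) → ℕ → ℕ → Bool
  | 0, _, _, _ => false
  | _ + 1, [], _, _ => false
  | m + 1, (P, Q) :: L, inside, outside =>
    bif Nat.beq (P &&& outside) 0 && Nat.beq (Q &&& inside) 0 then
      bif Nat.beq (P ||| Q ||| inside ||| outside) (inside ||| outside) then true
      else
        evalAt (fun a =>
          evalAt (fun s => familySearch n m ((P, Q) :: L) s outside)
              (inside ||| bitMask (fun b => dominates n 0 a b) (2 ^ n)) &&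
            evalAt (fun s => familySearch n m ((P, Q) :: L) inside s)
              (outside ||| bitMask (fun b => dominates n 0 b a) (2 ^ n)))
          (((P ||| Q ||| inside ||| outside) ^^^ (inside ||| outside)).log2)
    else familySearch n m L inside outside

/-- A packing of `n` items, with all multiplicities `mult`, and weights of the items that witness
its optimality relative to `capacity`. The bins are encoded in binary. -/
structure PackingCertificate where
  mult : ℕ
  capacity : ℕ
  weights : List ℕ
  bins : List ℕ

namespace PackingCertificate

/-- The packing has the multiplicities it should have, and the ratio of the number of bins to
the multiplicity is that of the total weight to the capacity. -/
def valid (n : ℕ) (c : PackingCertificate) : Bool :=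
  Nat.beq c.weights.length n && Nat.blt 0 c.capacity &&
    (List.range n).all (fun i => Nat.beq (c.bins.countP fun b => b.testBit i) c.mult) &&
    Nat.beq (c.mult * c.weights.sum) (c.capacity * c.bins.length)

/-- The sets that have to be admissible. -/
def insideMask (c : PackingCertificate) : ℕ :=
  c.bins.foldr (fun b m => 1 <<< b ||| m) 0

/-- The sets that must not be admissible. -/
def outsideMask (n : ℕ) (c : PackingCertificate) : ℕ :=
  bitMask (fun a => Nat.blt c.capacity (bitSum c.weights a)) (2 ^ n)

/-- The encodings of the required admissible and inadmissible sets of a list of certificates. -/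
def masks (n : ℕ) : List PackingCertificate → List (ℕ × ℕ)
  | [] => []
  | c :: L => evalAt (fun p => evalAt (fun q => (p, q) :: masks n L) (c.outsideMask n)) c.insideMask

end PackingCertificate

/-- Certificates for the optimal packings of six households, listed by decreasing demand. -/
def sixItemCertificates : List PackingCertificate := [
  ⟨1, 1, [1,1,1,1,1,1], [1,2,4,8,16,32]⟩,
  ⟨1, 1, [1,1,1,1,1,0], [1,2,4,8,48]⟩,
  ⟨2, 2, [2,2,2,1,1,1], [1,1,2,2,4,4,24,40,48]⟩,
  ⟨1, 1, [1,1,1,1,0,0], [1,2,24,36]⟩,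
  ⟨1, 2, [2,2,1,1,1,1], [1,2,24,36]⟩,
  ⟨1, 1, [1,1,1,1,0,0], [1,2,4,56]⟩,
  ⟨3, 3, [3,3,2,1,1,1], [1,1,1,2,2,2,12,20,36,56,56]⟩,
  ⟨2, 2, [2,2,1,1,1,0], [1,1,12,20,24,34,34]⟩,
  ⟨2, 2, [2,1,1,1,1,1], [1,1,12,20,24,34,34]⟩,
  ⟨2, 2, [2,2,1,1,1,0], [1,1,2,2,12,52,56]⟩,
  ⟨3, 3, [3,2,2,1,1,1], [1,1,1,12,12,18,18,34,36,56]⟩,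
  ⟨3, 3, [3,3,1,1,1,1], [1,1,1,2,2,2,28,44,52,56]⟩,
  ⟨4, 4, [4,3,2,2,1,1], [1,1,1,1,12,12,12,18,18,34,34,52,56]⟩,
  ⟨1, 1, [1,1,1,0,0,0], [12,18,33]⟩,
  ⟨1, 1, [1,1,1,0,0,0], [1,18,44]⟩,
  ⟨1, 2, [2,1,1,1,1,0], [1,10,52]⟩,
  ⟨1, 2, [1,1,1,1,1,1], [12,18,33]⟩,
  ⟨1, 1, [1,1,1,0,0,0], [1,28,34]⟩,
  ⟨1, 2, [2,1,1,1,1,0], [1,6,56]⟩,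
  ⟨1, 3, [3,2,1,1,1,1], [1,10,52]⟩,
  ⟨1, 1, [1,1,1,0,0,0], [1,2,60]⟩,
  ⟨1, 1, [1,1,1,0,0,0], [1,12,50]⟩,
  ⟨5, 5, [5,3,2,2,1,1], [1,1,1,1,1,6,10,28,28,44,44,50,50,50]⟩,
  ⟨4, 4, [3,2,2,2,1,1], [6,6,6,10,12,17,17,33,33,56,56]⟩,
  ⟨4, 4, [4,2,2,1,1,1], [1,1,1,1,6,28,28,42,42,50,52]⟩,
  ⟨4, 4, [4,3,1,1,1,1], [1,1,1,1,6,10,18,34,60,60,60]⟩,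
  ⟨3, 3, [3,2,1,1,1,0], [6,10,18,28,28,33,33,33]⟩,
  ⟨3, 3, [2,2,1,1,1,1], [6,6,6,9,17,33,56,56]⟩,
  ⟨3, 3, [3,1,1,1,1,1], [1,1,1,28,28,38,42,50]⟩,
  ⟨3, 3, [3,2,1,1,1,0], [1,1,1,6,10,50,60,60]⟩,
  ⟨3, 3, [2,2,1,1,1,1], [6,6,10,17,17,33,44,56]⟩,
  ⟨5, 5, [4,3,2,2,1,1], [6,6,10,10,17,17,17,17,33,44,44,44,50]⟩,
  ⟨5, 5, [5,3,2,1,1,1], [1,1,1,1,1,6,6,26,42,50,60,60,60]⟩,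
  ⟨2, 2, [1,1,1,1,1,0], [6,9,9,50,52]⟩,
  ⟨2, 2, [2,1,1,1,0,0], [6,17,17,42,44]⟩,
  ⟨2, 2, [2,1,1,1,0,0], [1,1,26,38,60]⟩,
  ⟨2, 2, [2,1,1,1,0,0], [6,26,28,33,33]⟩,
  ⟨2, 2, [2,1,1,1,0,0], [6,10,12,49,49]⟩,
  ⟨2, 4, [3,3,1,1,1,1], [6,10,17,33,60]⟩,
  ⟨2, 4, [3,2,2,1,1,1], [6,9,9,50,52]⟩,
  ⟨2, 2, [1,1,1,1,1,0], [3,5,6,56,56]⟩,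
  ⟨2, 2, [2,1,1,1,0,0], [6,10,17,33,60]⟩,
  ⟨2, 4, [4,2,1,1,1,1], [1,1,26,38,60]⟩,
  ⟨2, 2, [2,1,1,1,0,0], [1,1,6,58,60]⟩,
  ⟨5, 5, [4,3,2,1,1,1], [6,6,6,9,9,9,17,33,50,50,60,60]⟩,
  ⟨5, 5, [3,3,2,2,1,1], [6,6,6,9,9,9,28,44,49,49,50,50]⟩,
  ⟨5, 5, [5,2,2,1,1,1], [1,1,1,1,1,14,22,38,58,58,60,60]⟩,
  ⟨5, 5, [3,3,2,2,1,1], [5,5,5,9,9,10,28,44,50,50,50,50]⟩,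
  ⟨3, 3, [2,2,1,1,1,0], [6,6,9,28,42,49,49]⟩,
  ⟨3, 3, [2,1,1,1,1,1], [9,9,17,28,38,38,50]⟩,
  ⟨3, 3, [3,1,1,1,1,0], [14,22,26,28,33,33,33]⟩,
  ⟨3, 3, [2,1,1,1,1,1], [5,5,17,28,42,42,50]⟩,
  ⟨3, 3, [2,2,1,1,1,0], [5,5,9,10,50,50,60]⟩,
  ⟨3, 3, [3,1,1,1,1,0], [1,1,1,14,54,58,60]⟩,
  ⟨3, 3, [2,1,1,1,1,1], [3,3,3,28,44,52,56]⟩,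
  ⟨3, 3, [2,2,1,1,1,0], [9,9,17,28,38,38,50]⟩,
  ⟨3, 3, [2,1,1,1,1,1], [14,22,26,28,33,33,33]⟩,
  ⟨3, 3, [2,2,1,1,1,0], [6,6,9,10,49,49,60]⟩,
  ⟨3, 6, [4,3,3,2,1,1], [6,6,9,28,42,49,49]⟩,
  ⟨3, 6, [5,3,3,1,1,1], [6,6,9,17,33,58,60]⟩,
  ⟨7, 7, [5,4,3,2,1,1], [6,6,6,6,6,9,9,9,26,42,49,49,49,49,60,60]⟩,
  ⟨4, 4, [3,2,2,1,1,0], [6,6,6,26,28,41,41,49,49]⟩,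
  ⟨4, 4, [3,2,1,1,1,1], [9,9,17,17,26,38,38,38,60]⟩,
  ⟨4, 4, [2,2,2,1,1,1], [5,5,5,26,26,42,42,49,52]⟩,
  ⟨4, 4, [3,2,2,1,1,0], [9,9,17,17,26,38,38,38,60]⟩,
  ⟨4, 4, [2,2,2,1,1,1], [3,3,3,28,28,44,44,49,50]⟩,
  ⟨4, 4, [2,2,2,1,1,1], [6,6,6,26,28,41,41,49,49]⟩,
  ⟨4, 4, [3,2,1,1,1,1], [5,5,5,26,26,33,42,50,60]⟩,
  ⟨4, 4, [4,1,1,1,1,1], [1,1,1,1,30,46,54,58,60]⟩,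
  ⟨4, 4, [3,2,1,1,1,1], [14,14,14,17,17,33,33,50,60]⟩,
  ⟨4, 4, [3,2,2,1,1,0], [6,6,6,9,9,49,49,58,60]⟩,
  ⟨4, 4, [3,2,2,1,1,0], [6,9,9,26,28,38,38,49,49]⟩,
  ⟨5, 5, [3,2,2,2,1,1], [5,5,9,26,26,28,38,38,42,49,49]⟩,
  ⟨5, 5, [3,3,2,1,1,1], [5,5,5,6,26,26,42,42,49,49,60]⟩,
  ⟨5, 5, [4,2,2,1,1,1], [9,9,9,22,22,22,33,33,38,58,60]⟩,
  ⟨5, 5, [3,3,2,1,1,1], [6,6,6,6,25,26,41,41,49,49,60]⟩,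
  ⟨5, 5, [3,2,2,2,1,1], [9,9,9,22,22,22,38,42,44,49,49]⟩,
  ⟨5, 5, [4,2,2,1,1,1], [14,14,14,17,17,17,33,33,38,58,60]⟩,
  ⟨5, 5, [3,2,2,2,1,1], [3,3,9,28,28,28,38,38,42,49,49]⟩,
  ⟨6, 6, [4,3,2,2,1,1], [5,5,9,9,26,26,26,38,38,38,49,49,60]⟩,
  ⟨6, 6, [3,3,2,2,2,1], [3,3,3,28,28,28,28,38,38,41,42,49,49]⟩,
  ⟨6, 6, [4,3,3,1,1,1], [6,6,6,6,6,25,25,41,41,49,49,58,60]⟩,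
  ⟨6, 6, [4,3,2,2,1,1], [9,9,9,9,22,22,22,38,38,42,49,49,60]⟩,
  ⟨6, 6, [5,2,2,2,1,1], [14,14,14,14,17,17,17,33,33,33,54,58,60]⟩,
  ⟨7, 7, [4,3,3,2,2,1], [5,5,5,26,26,26,26,28,38,38,38,41,41,49,49]⟩,
  ⟨7, 7, [5,3,3,2,1,1], [9,9,9,9,9,22,22,22,38,38,38,49,49,58,60]⟩,
  ⟨8, 8, [5,4,3,2,2,1], [5,5,5,5,26,26,26,26,26,38,38,38,41,41,49,49,60]⟩,
  ⟨1, 1, [1,1,0,0,0,0], [22,41]⟩,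
  ⟨1, 2, [1,1,1,1,0,0], [3,60]⟩,
  ⟨1, 3, [2,1,1,1,1,0], [14,49]⟩,
  ⟨1, 1, [1,1,0,0,0,0], [5,58]⟩,
  ⟨1, 3, [1,1,1,1,1,1], [25,38]⟩,
  ⟨1, 1, [1,1,0,0,0,0], [30,33]⟩,
  ⟨1, 4, [2,2,1,1,1,1], [26,37]⟩,
  ⟨1, 3, [2,1,1,1,1,0], [9,54]⟩,
  ⟨1, 5, [3,2,2,1,1,1], [25,38]⟩,
  ⟨1, 4, [3,1,1,1,1,1], [3,60]⟩,
  ⟨1, 2, [1,1,1,1,0,0], [28,35]⟩,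
  ⟨1, 1, [1,1,0,0,0,0], [6,57]⟩,
  ⟨1, 2, [1,1,1,1,0,0], [22,41]⟩,
  ⟨1, 1, [1,1,0,0,0,0], [17,46]⟩,
  ⟨1, 1, [1,1,0,0,0,0], [1,62]⟩,
  ⟨9, 9, [5,4,3,2,2,1], [3,14,14,22,22,25,25,25,37,37,37,37,37,58,58,58,58]⟩,
  ⟨8, 8, [4,3,3,2,2,1], [14,14,22,22,25,25,25,35,35,35,35,37,60,60,60]⟩,
  ⟨8, 8, [5,3,3,2,1,1], [3,5,14,14,25,25,25,41,41,41,54,54,54,54,54]⟩,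
  ⟨7, 7, [4,3,2,2,1,1], [3,14,14,21,21,25,37,37,37,58,58,58,58]⟩,
  ⟨7, 7, [3,3,2,2,2,1], [14,14,21,21,25,26,35,35,35,35,60,60,60]⟩,
  ⟨7, 7, [4,3,2,2,1,1], [3,14,14,25,25,25,37,37,37,54,54,58,58]⟩,
  ⟨7, 7, [4,3,3,1,1,1], [3,5,14,14,22,22,38,38,57,57,57,57,57]⟩,
  ⟨7, 7, [5,2,2,2,1,1], [3,5,9,30,30,30,46,46,46,49,49,49,49]⟩,
  ⟨6, 6, [3,2,2,2,1,1], [14,14,21,21,21,35,37,41,58,58,58]⟩,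
  ⟨6, 6, [3,3,2,1,1,1], [3,14,14,22,22,37,37,57,57,57,58]⟩,
  ⟨6, 6, [4,2,2,1,1,1], [3,5,25,25,25,41,46,46,54,54,54]⟩,
  ⟨6, 6, [3,2,2,2,1,1], [14,14,25,25,25,35,37,41,54,54,54]⟩,
  ⟨6, 6, [3,2,2,2,1,1], [14,14,19,21,25,35,35,35,60,60,60]⟩,
  ⟨6, 6, [3,3,2,1,1,1], [3,13,14,21,21,37,37,58,58,58,58]⟩,
  ⟨6, 6, [4,2,2,1,1,1], [3,5,30,30,30,41,41,41,49,54,54]⟩,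
  ⟨5, 5, [2,2,2,1,1,1], [13,14,21,21,35,35,58,58,60]⟩,
  ⟨5, 5, [3,2,1,1,1,1], [3,25,25,25,37,46,46,54,54]⟩,
  ⟨5, 5, [3,2,2,1,1,0], [3,5,14,14,54,54,57,57,57]⟩,
  ⟨5, 5, [2,2,2,1,1,1], [14,14,22,22,35,37,57,57,57]⟩,
  ⟨5, 5, [2,2,2,1,1,1], [13,14,19,19,35,35,60,60,60]⟩,
  ⟨5, 5, [3,2,1,1,1,1], [3,13,13,13,49,54,54,58,58]⟩,
  ⟨5, 5, [3,2,2,1,1,0], [3,25,25,25,37,46,46,54,54]⟩,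
  ⟨5, 5, [3,2,1,1,1,1], [3,30,30,30,37,37,41,49,58]⟩,
  ⟨5, 5, [4,1,1,1,1,1], [3,5,9,17,33,62,62,62,62]⟩,
  ⟨9, 9, [5,4,3,2,1,1], [3,3,14,14,14,14,21,37,54,54,54,57,57,57,57,57]⟩,
  ⟨4, 4, [2,1,1,1,1,1], [13,13,25,35,54,54,58]⟩,
  ⟨4, 4, [2,2,1,1,1,0], [3,21,21,46,46,57,58]⟩,
  ⟨4, 4, [2,2,1,1,1,0], [3,14,14,53,53,57,58]⟩,
  ⟨4, 4, [2,1,1,1,1,1], [21,25,25,35,46,46,54]⟩,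
  ⟨4, 4, [3,1,1,1,1,0], [3,5,9,49,62,62,62]⟩,
  ⟨4, 4, [2,2,1,1,1,0], [3,13,13,54,54,57,58]⟩,
  ⟨4, 8, [4,3,3,2,1,1], [14,14,21,35,54,57,57]⟩,
  ⟨4, 4, [2,1,1,1,1,1], [7,11,19,35,60,60,60]⟩,
  ⟨4, 4, [2,1,1,1,1,1], [30,30,30,35,37,41,49]⟩,
  ⟨4, 8, [5,3,3,1,1,1], [3,5,30,46,54,57,57]⟩,
  ⟨7, 7, [4,3,2,1,1,1], [3,3,30,30,30,37,37,46,54,57,57,57]⟩,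
  ⟨7, 7, [3,3,2,2,1,1], [13,13,14,14,19,35,54,54,54,57,57,57]⟩,
  ⟨7, 7, [3,3,2,2,1,1], [14,14,14,14,19,35,53,53,53,57,57,58]⟩,
  ⟨7, 7, [5,2,2,1,1,1], [3,3,5,5,25,41,49,62,62,62,62,62]⟩,
  ⟨3, 3, [1,1,1,1,1,0], [19,21,46,46,57]⟩,
  ⟨3, 3, [2,1,1,1,0,0], [3,25,37,62,62]⟩,
  ⟨3, 3, [1,1,1,1,1,0], [11,13,54,54,57]⟩,
  ⟨3, 3, [2,1,1,1,0,0], [30,30,35,37,57]⟩,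
  ⟨3, 6, [3,3,1,1,1,1], [3,30,46,53,57]⟩,
  ⟨3, 6, [3,2,2,1,1,1], [30,30,35,37,57]⟩,
  ⟨3, 3, [1,1,1,1,1,0], [14,14,51,53,57]⟩,
  ⟨3, 3, [1,1,1,1,1,0], [7,7,57,58,60]⟩,
  ⟨3, 3, [2,1,1,1,0,0], [3,5,57,62,62]⟩,
  ⟨3, 6, [4,2,1,1,1,1], [3,25,37,62,62]⟩,
  ⟨8, 8, [4,3,2,2,1,1], [13,30,30,30,30,35,35,35,46,53,53,57,57]⟩,
  ⟨8, 8, [5,3,2,1,1,1], [3,3,3,13,21,37,57,57,62,62,62,62,62]⟩,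
  ⟨5, 5, [2,2,1,1,1,1], [30,30,30,35,35,45,53,57]⟩,
  ⟨5, 5, [3,2,1,1,1,0], [3,3,13,53,57,62,62,62]⟩,
  ⟨5, 5, [3,1,1,1,1,1], [13,21,25,35,35,62,62,62]⟩,
  ⟨5, 5, [2,2,1,1,1,1], [11,11,30,46,53,53,53,58]⟩,
  ⟨5, 5, [2,2,1,1,1,1], [7,7,30,46,54,57,57,57]⟩,
  ⟨5, 5, [3,2,1,1,1,0], [13,21,25,35,35,62,62,62]⟩,
  ⟨7, 7, [3,2,2,2,1,1], [13,13,30,30,46,46,51,51,51,53,57]⟩,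
  ⟨7, 7, [4,2,2,1,1,1], [13,13,19,21,35,35,57,62,62,62,62]⟩,
  ⟨7, 7, [4,3,1,1,1,1], [3,3,3,29,45,53,57,62,62,62,62]⟩,
  ⟨9, 9, [5,3,2,2,1,1], [13,13,13,19,19,35,35,53,57,62,62,62,62,62]⟩,
  ⟨2, 2, [1,1,1,0,0,0], [30,45,51]⟩,
  ⟨2, 4, [1,1,1,1,1,1], [30,45,51]⟩,
  ⟨2, 4, [2,1,1,1,1,0], [11,53,62]⟩,
  ⟨2, 2, [1,1,1,0,0,0], [29,35,62]⟩,
  ⟨2, 6, [3,2,1,1,1,1], [19,45,62]⟩,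
  ⟨2, 2, [1,1,1,0,0,0], [13,51,62]⟩,
  ⟨2, 2, [1,1,1,0,0,0], [3,61,62]⟩,
  ⟨2, 4, [2,1,1,1,1,0], [7,57,62]⟩,
  ⟨9, 9, [4,3,2,2,1,1], [7,11,29,29,45,45,51,51,51,62,62,62,62]⟩,
  ⟨7, 7, [3,2,2,1,1,1], [7,29,29,43,45,51,51,62,62,62]⟩,
  ⟨7, 7, [3,3,1,1,1,1], [7,11,19,35,61,61,61,62,62,62]⟩,
  ⟨5, 5, [2,1,1,1,1,1], [29,29,39,43,51,62,62]⟩,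
  ⟨5, 5, [2,2,1,1,1,0], [7,11,51,61,61,62,62]⟩,
  ⟨8, 8, [3,3,2,1,1,1], [7,7,27,43,51,61,61,61,62,62,62]⟩,
  ⟨3, 3, [1,1,1,1,0,0], [27,39,61,62]⟩,
  ⟨3, 6, [2,2,1,1,1,1], [27,39,61,62]⟩,
  ⟨3, 3, [1,1,1,1,0,0], [7,59,61,62]⟩,
  ⟨7, 7, [2,2,2,1,1,1], [15,23,39,59,59,61,61,62,62]⟩,
  ⟨4, 4, [1,1,1,1,1,0], [15,55,59,61,62]⟩,
  ⟨5, 5, [1,1,1,1,1,1], [31,47,55,59,61,62]⟩,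
  ⟨1, 1, [1,0,0,0,0,0], [63]⟩]

theorem evalAt_eq {α : Type} (f : ℕ → α) (n : ℕ) : evalAt f n = f n := by
  cases n <;> rfl

theorem testBit_bitMask {p : ℕ → Bool} {n a : ℕ} :
    (bitMask p n).testBit a = (decide (a < n) && p a) := by
  induction n with
  | zero => simp [bitMask]
  | succ n ih =>
    rw [bitMask, Nat.testBit_or, ih]
    rcases lt_trichotomy a n with h | rfl | h
    · have : ¬ n ≤ a := by omega
      cases p n <;> simp [h, this, Nat.lt_succ_of_lt h, Nat.testBit_shiftLeft]
    · cases h : p a <;> simp [Nat.testBit_shiftLeft]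
    · have h₁ : ¬ a < n := by omega
      have h₂ : ¬ a < n + 1 := by omega
      have h₃ : a - n ≠ 0 := by omega
      have h₄ : Nat.testBit 1 (a - n) = false := by
        rw [Bool.eq_false_iff, Ne, Nat.testBit_one_eq_true_iff_self_eq_zero]
        exact h₃
      cases p n <;> simp [h₁, h₂, h₄, Nat.testBit_shiftLeft]

theorem mem_bitSet {n a : ℕ} {i : Fin n} : i ∈ bitSet n a ↔ a.testBit i = true := by
  simp [bitSet]

theorem sum_bitSet {R : Type*} [AddCommMonoid R] {n : ℕ} (d : Fin n → R) (a : ℕ) :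
    ∑ i ∈ bitSet n a, d i = bitSum (List.ofFn d) a := by
  rw [bitSet, Finset.sum_filter]
  induction n generalizing a with
  | zero => simp [bitSum]
  | succ n ih =>
    rw [Fin.sum_univ_succ, List.ofFn_succ, bitSum, ← ih (fun i => d i.succ)]
    simp only [Fin.val_zero, Fin.val_succ, Nat.testBit_succ, Nat.testBit_zero, decide_eq_true_eq]
    split_ifs <;> simp

theorem exists_bitSet_eq {n : ℕ} (A : Finset (Fin n)) : ∃ a < 2 ^ n, bitSet n a = A := by
  refine ⟨bitMask (fun j => decide (∃ i ∈ A, (i : ℕ) = j)) n, ?_, ?_⟩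
  · refine Nat.lt_pow_two_of_testBit _ fun i hi => ?_
    rw [testBit_bitMask]
    simp [hi]
  · ext i
    rw [mem_bitSet, testBit_bitMask]
    simp [← Fin.ext_iff]

theorem bitSum_le_of_dominates {n c a b : ℕ} {l : List ℝ} {M : ℝ} (h : dominates n c a b = true)
    (hn : l.length = n) (hl : l.Pairwise (· ≥ ·)) (h0 : ∀ x ∈ l, 0 ≤ x) (hM0 : 0 ≤ M)
    (hM : ∀ x ∈ l, x ≤ M) : bitSum l b ≤ bitSum l a + c * M := by
  induction l generalizing n c a b M with
  | nil =>
    simp only [bitSum, zero_add]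
    positivity
  | cons x l ih =>
    subst hn
    rw [List.length_cons, dominates, Bool.and_eq_true, Nat.ble_eq] at h
    rw [List.pairwise_cons] at hl
    have hx : 0 ≤ x := h0 x List.mem_cons_self
    have key := ih h.2 rfl hl.2 (fun z hz => h0 z (List.mem_cons_of_mem _ hz)) hx hl.1
    rw [Nat.cast_sub h.1, Nat.cast_add] at key
    have hc : (c : ℝ) * x ≤ c * M :=
      mul_le_mul_of_nonneg_left (hM x List.mem_cons_self) (Nat.cast_nonneg c)
    simp only [bitSum]
    rcases Nat.mod_two_eq_zero_or_one a with ha | ha <;>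
      rcases Nat.mod_two_eq_zero_or_one b with hb | hb <;>
      simp only [ha, hb, Nat.cast_zero, Nat.cast_one, if_true, zero_ne_one, if_false] at key ⊢ <;>
      linarith

theorem exists_of_familySearch {n : ℕ} {p : ℕ → Prop}
    (hp : ∀ a b, dominates n 0 a b = true → p a → p b) {m : ℕ} {L : List (ℕ × ℕ)}
    {inside outside : ℕ} (h : familySearch n m L inside outside = true)
    (hin : ∀ a, inside.testBit a = true → p a) (hout : ∀ a, outside.testBit a = true → ¬ p a) :
    ∃ x ∈ L, (∀ a, x.1.testBit a = true → p a) ∧ ∀ a, x.2.testBit a = true → ¬ p a := by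
  induction m generalizing L inside outside with
  | zero => simp [familySearch] at h
  | succ m ih =>
    match L with
    | [] => simp [familySearch] at h
    | (P, Q) :: L =>
      simp only [familySearch, evalAt_eq, cond_eq_ite, Bool.and_eq_true, Nat.beq_eq] at h
      split_ifs at h with h₁ h₂
      · refine ⟨(P, Q), List.mem_cons_self, fun a ha => ?_, fun a ha => ?_⟩
        · have e₁ := congrArg (fun z => z.testBit a) h₁.1
          have e₂ := congrArg (fun z => z.testBit a) h₂
          simp only at ha
          simp only [Nat.testBit_and, Nat.testBit_or, Nat.zero_testBit, ha] at e₁ e₂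
          apply hin
          simp_all
        · have e₁ := congrArg (fun z => z.testBit a) h₁.2
          have e₂ := congrArg (fun z => z.testBit a) h₂
          simp only at ha
          simp only [Nat.testBit_and, Nat.testBit_or, Nat.zero_testBit, ha] at e₁ e₂
          apply hout
          simp_all
      · rw [Bool.and_eq_true] at h
        set s := (((P ||| Q ||| inside ||| outside) ^^^ (inside ||| outside)).log2)
        by_cases hs : p s
        · refine ih h.1 (fun a ha => ?_) hout
          rw [Nat.testBit_or, Bool.or_eq_true, testBit_bitMask, Bool.and_eq_true] at ha
          exact ha.elim (hin a) fun h' => hp _ _ h'.2 hs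
        · refine ih h.2 hin fun a ha => ?_
          rw [Nat.testBit_or, Bool.or_eq_true, testBit_bitMask, Bool.and_eq_true] at ha
          exact ha.elim (hout a) fun h' h'' => hs (hp _ _ h'.2 h'')
      · obtain ⟨x, hx, hx'⟩ := ih h hin hout
        exact ⟨x, List.mem_cons_of_mem _ hx, hx'⟩

namespace PackingCertificate

theorem testBit_insideMask {c : PackingCertificate} {b : ℕ} (hb : b ∈ c.bins) :
    c.insideMask.testBit b = true := by
  unfold insideMask
  revert hb
  induction c.bins with
  | nil => simp
  | cons x l ih =>
    intro hb
    rw [List.foldr_cons, Nat.testBit_or, Bool.or_eq_true]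
    rcases List.mem_cons.1 hb with rfl | h
    · left
      simp [Nat.testBit_shiftLeft]
    · exact Or.inr (ih h)

theorem masks_eq_map (n : ℕ) (L : List PackingCertificate) :
    masks n L = L.map fun c => (c.insideMask, c.outsideMask n) := by
  induction L with
  | nil => rfl
  | cons c L ih => simp only [masks, evalAt_eq, ih, List.map_cons]

end PackingCertificate

theorem card_filter_get {α : Type*} (l : List α) (p : α → Bool) :
    (Finset.univ.filter fun j : Fin l.length => p (l.get j) = true).card = l.countP p := by
  induction l with
  | nil => simp
  | cons x l ih =>
    rw [List.countP_cons, ← ih]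
    refine (Fin.card_filter_univ_succ _).trans ?_
    by_cases h : p x = true <;> simp [h]

namespace ElectricityInstance

variable {n : ℕ} {D : ElectricityInstance n}

theorem admissible_bitSet {a : ℕ} :
    D.Admissible (bitSet n a) ↔ bitSum (List.ofFn D.demand) a ≤ D.supply := by
  rw [Admissible, sum_bitSet]

theorem hasTightPacking_of_certificate {c : PackingCertificate} (hc : c.valid n = true)
    (hin : ∀ b ∈ c.bins, D.Admissible (bitSet n b))
    (hout : ∀ a < 2 ^ n, c.capacity < bitSum c.weights a → ¬ D.Admissible (bitSet n a)) :
    D.HasTightPacking c.mult c.bins.length := by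
  simp only [PackingCertificate.valid, Bool.and_eq_true, Nat.beq_eq, List.all_eq_true,
    List.mem_range, Nat.blt_eq] at hc
  obtain ⟨⟨⟨hlen, hcap⟩, hcount⟩, hsum⟩ := hc
  have hcap' : (0 : ℝ) < c.capacity := by exact_mod_cast hcap
  obtain ⟨w, hw⟩ : ∃ w : Fin n → ℕ, c.weights = List.ofFn w := by
    subst hlen
    exact ⟨c.weights.get, (List.ofFn_get c.weights).symm⟩
  refine ⟨⟨fun j => bitSet n (c.bins.get j), fun j => hin _ (List.get_mem _ _), fun i => ?_⟩,
    fun i => (w i : ℝ) / c.capacity, fun i => by positivity, fun A hA => ?_, ?_⟩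
  · simp only [mem_bitSet]
    rw [← hcount i i.2]
    exact card_filter_get c.bins fun b => b.testBit i
  · obtain ⟨a, ha, rfl⟩ := exists_bitSet_eq A
    have h : bitSum c.weights a ≤ c.capacity := not_lt.1 fun h => hout a ha h hA
    rw [hw, ← sum_bitSet] at h
    rw [← Finset.sum_div, div_le_one hcap']
    exact_mod_cast h
  · rw [hw, List.sum_ofFn] at hsum
    rw [← Finset.sum_div, mul_div_assoc', div_eq_iff hcap'.ne', mul_comm _ (c.capacity : ℝ)]
    exact_mod_cast hsum

end ElectricityInstance

theorem sixItemCertificates_valid :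
    sixItemCertificates.all
      (fun c => c.valid 6 && Nat.ble 1 c.mult && Nat.ble c.mult 9) = true := by
  decide +kernel

theorem familySearch_sixItemCertificates :
    familySearch 6 300 (PackingCertificate.masks 6 sixItemCertificates)
      (bitMask (fun b => dominates 6 0 1 b) (2 ^ 6)) 0 = true := by
  decide +kernel

namespace ElectricityInstance

theorem bitSum_demand_le_of_dominates {n : ℕ} {D : ElectricityInstance n}
    (hD : Antitone D.demand) {a b : ℕ} (h : dominates n 0 a b = true) :
    bitSum (List.ofFn D.demand) b ≤ bitSum (List.ofFn D.demand) a := by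
  have h0 : ∀ x ∈ List.ofFn D.demand, 0 ≤ x := by
    intro x hx
    obtain ⟨i, rfl⟩ := (List.mem_ofFn' _ _).1 hx
    exact (D.demand_pos i).le
  have hM : ∀ x ∈ List.ofFn D.demand, x ≤ D.supply := by
    intro x hx
    obtain ⟨i, rfl⟩ := (List.mem_ofFn' _ _).1 hx
    exact D.demand_le_supply i
  have hl : (List.ofFn D.demand).Pairwise (· ≥ ·) :=
    List.pairwise_ofFn.2 fun i j hij => hD hij.le
  simpa using bitSum_le_of_dominates h (by simp) hl h0 D.supply_pos.le hM

theorem exists_hasTightPacking_of_antitone {D : ElectricityInstance 6} (hD : Antitone D.demand) :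
    ∃ k q, 1 ≤ k ∧ k ≤ 9 ∧ D.HasTightPacking k q := by
  have hp : ∀ a b, dominates 6 0 a b = true → D.Admissible (bitSet 6 a) →
      D.Admissible (bitSet 6 b) := fun a b h ha =>
    admissible_bitSet.2 ((bitSum_demand_le_of_dominates hD h).trans (admissible_bitSet.1 ha))
  have h1 : D.Admissible (bitSet 6 1) := by
    have : bitSet 6 1 = {0} := by decide
    simpa [Admissible, this] using D.demand_le_supply 0
  obtain ⟨x, hx, hin, hout⟩ := exists_of_familySearch (p := fun a => D.Admissible (bitSet 6 a)) hp
    familySearch_sixItemCertificates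
    (fun a ha => by
      rw [testBit_bitMask, Bool.and_eq_true] at ha
      exact hp _ _ ha.2 h1)
    (fun a ha => by simp at ha)
  rw [PackingCertificate.masks_eq_map, List.mem_map] at hx
  obtain ⟨c, hc, rfl⟩ := hx
  have hv := List.all_eq_true.1 sixItemCertificates_valid c hc
  simp only [Bool.and_eq_true, Nat.ble_eq] at hv
  refine ⟨c.mult, c.bins.length, hv.1.2, hv.2, hasTightPacking_of_certificate hv.1.1
    (fun b hb => hin b (PackingCertificate.testBit_insideMask hb)) fun a ha h => hout a ?_⟩
  rw [PackingCertificate.outsideMask, testBit_bitMask, Bool.and_eq_true, Nat.blt_eq]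
  exact ⟨decide_eq_true ha, h⟩

theorem exists_hasTightPacking (D : ElectricityInstance 6) :
    ∃ k q, 1 ≤ k ∧ k ≤ 9 ∧ D.HasTightPacking k q := by
  have hD : Antitone (D.permute (Tuple.sort fun i => -D.demand i)).demand := fun i j hij =>
    neg_le_neg_iff.1 (Tuple.monotone_sort (fun i => -D.demand i) hij)
  obtain ⟨k, q, h₁, h₂, h⟩ := exists_hasTightPacking_of_antitone hD
  exact ⟨k, q, h₁, h₂, h.of_permute⟩

theorem isLeast_minK (D : ElectricityInstance 6) : IsLeast D.optimalMultiplicities D.minK := by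
  obtain ⟨k, q, h₁, -, h⟩ := D.exists_hasTightPacking
  exact ⟨Nat.sInf_mem ⟨k, h.mem_optimalMultiplicities h₁⟩, fun m hm => Nat.sInf_le hm⟩

theorem minK_le_nine (D : ElectricityInstance 6) : D.minK ≤ 9 := by
  obtain ⟨k, q, h₁, h₂, h⟩ := D.exists_hasTightPacking
  exact (D.isLeast_minK.2 (h.mem_optimalMultiplicities h₁)).trans h₂

theorem hasTightPacking_nine {D : ElectricityInstance 6} (hd : D.demand = ![4, 2, 5, 3, 2, 1])
    (hS : D.supply = 9) : D.HasTightPacking 9 17 := by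
  have key : ∀ A, D.Admissible A ↔ ∑ i ∈ A, (![4, 2, 5, 3, 2, 1] : Fin 6 → ℕ) i ≤ 9 := by
    intro A
    have h : D.demand = fun i => (((![4, 2, 5, 3, 2, 1] : Fin 6 → ℕ) i : ℕ) : ℝ) := by
      rw [hd]
      funext i
      fin_cases i <;> simp
    simp only [Admissible, hS, h]
    exact_mod_cast Iff.rfl
  refine hasTightPacking_of_certificate (c := ⟨9, 9, List.ofFn ![4, 2, 5, 3, 2, 1],
    [5, 11, 11, 22, 22, 22, 25, 25, 44, 44, 44, 44, 44, 51, 51, 51, 51]⟩)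
    (by decide +kernel) ?_ ?_
  · simp only [key]
    decide +kernel
  · intro a _ ha
    rw [key, sum_bitSet]
    exact not_le.2 ha

/-- The demands `4, 2, 5, 3, 2, 1` with supply `9`, on a time interval of length `1`. -/
def extremalInstance : ElectricityInstance 6 where
  horizon := 1
  supply := 9
  demand := ![4, 2, 5, 3, 2, 1]
  horizon_pos := one_pos
  supply_pos := by norm_num
  demand_pos i := by fin_cases i <;> simp
  demand_le_supply i := by fin_cases i <;> norm_num [Matrix.cons_val]

theorem isGreatest_nine : IsGreatest (Set.range fun D : ElectricityInstance 6 => D.minK) 9 := by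
  refine ⟨⟨extremalInstance, ?_⟩, ?_⟩
  · exact (hasTightPacking_nine rfl rfl).minK_eq (by norm_num) (by norm_num)
  · rintro _ ⟨D, rfl⟩
    exact D.minK_le_nine

end ElectricityInstance

open ElectricityInstance in
theorem maxMinK_six : maxMinK 6 = 9 :=
  isGreatest_nine.csSup_eq

/-- `K(6) = 9`. The first two conjuncts say that `K(D)` and `K(6)` are a genuine minimum and a
genuine maximum; the last one says that the maximum is attained by the demands
`4, 2, 5, 3, 2, 1` with supply `9`, for which `OPT(D_9) = 17`. -/
theorem mainTheorem8 :
    (∀ D : ElectricityInstance 6, IsLeast D.optimalMultiplicities D.minK) ∧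
    IsGreatest (Set.range fun D : ElectricityInstance 6 => D.minK) (maxMinK 6) ∧
    maxMinK 6 = 9 ∧
    ∀ D : ElectricityInstance 6, D.demand = ![4, 2, 5, 3, 2, 1] → D.supply = 9 →
      D.opt 9 = 17 ∧ D.minK = 9 := by
  refine ⟨fun D => D.isLeast_minK, ?_, maxMinK_six, fun D hd hS => ?_⟩
  · rw [maxMinK_six]
    exact ElectricityInstance.isGreatest_nine
  · have h := ElectricityInstance.hasTightPacking_nine hd hS
    exact ⟨h.opt_eq, h.minK_eq (by norm_num) (by norm_num)⟩
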